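/- Let $0<s<1$ and $1<p<\infty$. Let $\mathbb{S}^1$ be the unit circle with arc-length measure, and for a measurable $g:\mathbb{S}^1\to\mathbb{C}$ put $$[g]_{W^{s,p}(\mathbb{S}^1)}:=\Big(\iint_{(-\pi,\pi)\times(-\pi,\pi)}\frac{|g(e^{i\xi})-g(e^{i\sigma})|^p}{|e^{i\xi}-e^{i\sigma}|^{1+sp}}\,d\xi\,d\sigma\Big)^{1/p}\in[0,\infty],$$ and $W^{s,p}(\mathbb{S}^1):=\{g\in L^p(\mathbb{S}^1):[g]_{W^{s,p}(\mathbb{S}^1)}<\infty\}$. Let $u$ be an analytic function on the open unit disc $\mathbb{D}$, and for $0<r<1$ let $u_r(\xi):=u(r\xi)$, $\xi\in\mathbb{S}^1$. Then each $u_r$, $0<r<1$, is smooth on $\mathbb{S}^1$ and lies in $W^{s,p}(\mathbb{S}^1)$. Assume moreover that $$\sup_{0<r<1}[u_r]_{W^{s,p}(\mathbb{S}^1)}<\infty.$$ Then the following hold. 1. $u$ belongs to the Hardy space $\mathbf{H}^p(\mathbb{D})$, i.e. $\sup_{0\le r<1}\big(\frac1{2\pi}\int_0^{2\pi}|u(re^{i\theta})|^p\,d\theta\big)^{1/p}<\infty$,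 and $u$ admits a radial boundary trace $u^*\in L^p(\mathbb{S}^1)$: $\lim_{r\to1^-}u(re^{i\theta})=u^*(e^{i\theta})$ for almost every $\theta\in(-\pi,\pi)$, and $\|u_r-u^*\|_{L^p(\mathbb{S}^1)}\to0$ as $r\to1^-$. 2. $u^*\in W^{s,p}(\mathbb{S}^1)$. 3. $\lim_{r\to1^-}[u_r-u^*]_{W^{s,p}(\mathbb{S}^1)}=0$, and in particular $[u_r]_{W^{s,p}(\mathbb{S}^1)}\to[u^*]_{W^{s,p}(\mathbb{S}^1)}$ as $r\to1^-$. -/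

import Mathlib

open MeasureTheory Set Filter Topology
open scoped ENNReal ContDiff Manifold

noncomputable section

instance Circle.borelMeasurableSpace : MeasurableSpace Circle := borel Circle

instance Circle.borelSpaceInst : BorelSpace Circle := ⟨rfl⟩

/-- Arc-length measure on the unit circle: the image of Lebesgue measure on `(-π, π)` under
`θ ↦ e^{iθ}` (total mass `2π`). -/
def arcLength : Measure Circle :=
  (volume.restrict (Ioo (-Real.pi) Real.pi)).map Circle.exp

/-- The Gagliardo seminorm `[g]_{W^{s,p}(S¹)}` of a complex-valued function on the unit circle,
with values in `[0, ∞]`: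
`(∬_{(-π,π)²} |g(e^{iξ}) - g(e^{iσ})|^p / |e^{iξ} - e^{iσ}|^{1+sp} dξ dσ)^{1/p}`. -/
def gagliardoSeminorm (s p : ℝ) (g : Circle → ℂ) : ℝ≥0∞ :=
  (∫⁻ z : ℝ × ℝ in Ioo (-Real.pi) Real.pi ×ˢ Ioo (-Real.pi) Real.pi,
    ‖g (Circle.exp z.1) - g (Circle.exp z.2)‖ₑ ^ p /
      ‖(Circle.exp z.1 : ℂ) - (Circle.exp z.2 : ℂ)‖ₑ ^ (1 + s * p)) ^ (1 / p)

/-- Membership in `L^p(S¹)` (complex-valued functions). -/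
def MemLpCircle (p : ℝ) (g : Circle → ℂ) : Prop :=
  MemLp g (ENNReal.ofReal p) arcLength

/-- Membership in the fractional Sobolev space `W^{s,p}(S¹)` (complex-valued functions). -/
def MemFracSobolev (s p : ℝ) (g : Circle → ℂ) : Prop :=
  MemLpCircle p g ∧ gagliardoSeminorm s p g < ⊤

/-- The radial restriction `u_r : ξ ↦ u (r ξ)` on the unit circle. -/
def radialRestriction (u : ℂ → ℂ) (r : ℝ) : Circle → ℂ :=
  fun ξ => u ((r : ℂ) * (ξ : ℂ))

/-- `sup_{0 < r < 1} [u_r]_{W^{s,p}(S¹)}`, with values in `[0, ∞]`. -/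
def supGagliardo (s p : ℝ) (u : ℂ → ℂ) : ℝ≥0∞ :=
  ⨆ r ∈ Ioo (0 : ℝ) 1, gagliardoSeminorm s p (radialRestriction u r)

/-- The Hardy norm `sup_{0 ≤ r < 1} ((2π)⁻¹ ∫_0^{2π} |f(r e^{iθ})|^p dθ)^{1/p}`, with values in
`[0, ∞]`. -/
def hardyNorm (p : ℝ) (f : ℂ → ℂ) : ℝ≥0∞ :=
  ⨆ r ∈ Ico (0 : ℝ) 1,
    (ENNReal.ofReal (1 / (2 * Real.pi)) *
      ∫⁻ θ in Ioo (0 : ℝ) (2 * Real.pi), ‖f ((r : ℂ) * (Circle.exp θ : ℂ))‖ₑ ^ p) ^ (1 / p)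

/-- Membership in the Hardy space `H^p(𝔻)`: analytic on the open unit disc with finite
Hardy norm. -/
def MemHardy (p : ℝ) (f : ℂ → ℂ) : Prop :=
  AnalyticOnNhd ℂ f (Metric.ball 0 1) ∧ hardyNorm p f < ⊤

end

/-!
Write `u_r` for the restriction of `u` to the circle of radius `r`, regarded as a function on the
unit circle. For `r < R < 1` it is the Poisson average of `u_R` with parameter `ρ = r / R`, and
everything follows from two properties of such averages.

*Rate.* By Jensen's inequality `|u_r x - u_R x| ^ p` is at most the Poisson average of
`t ↦ |u_R (x t) - u_R x| ^ p`. The Poisson kernel times `|t - 1| ^ (1 + s p)` is bounded by a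
multiple of `(1 - ρ) ^ min 1 (s p)` (`poissonKernel_mul_chord_rpow_le`), so the average is at most
that quantity times `G_R x`, the part of the Gagliardo energy of `u_R` at `x`
(`enorm_poisson_sub_rpow_le`). This pointwise estimate replaces the maximal function. With `ρ = 0`
it is a Poincaré inequality, which bounds the Hardy norm. By Fatou's lemma `liminf G_R` along a
sequence `R → 1` is finite almost everywhere, and where it is finite the radial values form a
Cauchy family; this gives the boundary function `v` (`ae_exists_radial_limit`). Integrating the
estimate over the circle gives the convergence in `L ^ p`
(`lintegral_radialRestriction_sub_le`).

*Contraction.* The energy is convex and rotation invariant, so averaging does not increase it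
(`gagliardoEnergy_average_le`). Since `u_r` is also the Poisson average of `v`
(`integral_poissonMeasure_boundary`), its energy is at most that of `v`; by Fatou's lemma the
energy of `v` is at most the lower limit of those of `u_r`. Hence the energies converge, and
together with almost everywhere convergence of the difference quotients this gives convergence in
the seminorm (`tendsto_lintegral_zero_of_le_add`).
-/

/-! ### Arc length on the unit circle -/

/-- The integral over a half-open period does not depend on where the period starts. -/
lemma setLIntegral_Ioc_circleExp_eq (f : Circle → ℝ≥0∞) (a b : ℝ) :
    ∫⁻ θ in Ioc a (a + 2 * Real.pi), f (Circle.exp θ) =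
      ∫⁻ θ in Ioc b (b + 2 * Real.pi), f (Circle.exp θ) := by
  have : Fact (0 < 2 * Real.pi) := ⟨Real.two_pi_pos⟩
  have key := fun t : ℝ => AddCircle.lintegral_preimage (2 * Real.pi) t
    (fun x => f (AddCircle.toCircle x))
  have hπ : (2 * Real.pi) ≠ 0 := Real.two_pi_pos.ne'
  simp only [AddCircle.toCircle_apply_mk, div_self hπ, one_mul] at key
  rw [key a, key b]

lemma measurable_circleExp : Measurable Circle.exp :=
  Circle.exp.continuous.measurable

lemma lintegral_arcLength {f : Circle → ℝ≥0∞} (hf : Measurable f) (a : ℝ) :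
    ∫⁻ x, f x ∂arcLength = ∫⁻ θ in Ioc a (a + 2 * Real.pi), f (Circle.exp θ) := by
  rw [arcLength, lintegral_map hf measurable_circleExp, restrict_Ioo_eq_restrict_Ioc,
    setLIntegral_Ioc_circleExp_eq f a (-Real.pi)]
  congr 3
  ring

instance : IsFiniteMeasure arcLength := by
  unfold arcLength
  infer_instance

/-- Arc length is invariant under rotations. -/
instance : arcLength.IsMulLeftInvariant := by
  refine ⟨fun g => ?_⟩
  obtain ⟨α, rfl⟩ := Circle.exp_surjective g
  refine Measure.ext_of_lintegral _ fun f hf => ?_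
  have hm : Measurable fun x : Circle => Circle.exp α * x := measurable_const_mul _
  rw [lintegral_map hf hm,
    lintegral_arcLength (f := fun x => f (Circle.exp α * x)) (hf.comp hm) 0,
    lintegral_arcLength hf α]
  have hpre : (fun θ : ℝ => α + θ) ⁻¹' Ioc α (α + 2 * Real.pi) =
      Ioc 0 (0 + 2 * Real.pi) := by
    ext θ; simp
  have key := (measurePreserving_add_left volume α).setLIntegral_comp_preimage
    (measurableSet_Ioc (a := α) (b := α + 2 * Real.pi)) (hf.comp measurable_circleExp)
  rw [hpre] at key
  simpa [Function.comp_def, Circle.exp_add] using key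

lemma arcLength_eq_map_Ioc :
    arcLength = (volume.restrict (Ioc 0 (2 * Real.pi))).map Circle.exp := by
  refine Measure.ext_of_lintegral _ fun f hf => ?_
  rw [lintegral_arcLength hf 0, lintegral_map hf measurable_circleExp, zero_add]

lemma circleAverage_eq_integral_arcLength {f : ℂ → ℂ}
    (hf : Measurable fun x : Circle => f x) :
    Real.circleAverage f 0 1 = (2 * Real.pi)⁻¹ • ∫ x : Circle, f x ∂arcLength := by
  rw [Real.circleAverage_def, intervalIntegral.integral_of_le Real.two_pi_pos.le,
    arcLength_eq_map_Ioc, integral_map measurable_circleExp.aemeasurable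
      hf.aestronglyMeasurable]
  simp [circleMap, Circle.coe_exp]

/-! ### Poisson averages -/

/-- The Poisson kernel of the point `ρ` of the unit disc, as a measure on the unit circle. It is
normalized to total mass `1`. -/
noncomputable def poissonMeasure (ρ : ℝ) : Measure Circle :=
  arcLength.withDensity fun t : Circle =>
    ENNReal.ofReal ((2 * Real.pi)⁻¹ * poissonKernel 0 (ρ : ℂ) (t : ℂ))

lemma poissonKernel_circle (ρ : ℝ) (t : Circle) :
    poissonKernel 0 (ρ : ℂ) (t : ℂ) = (1 - ρ ^ 2) / ‖(t : ℂ) - ρ‖ ^ 2 := by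
  simp [poissonKernel_def, Circle.norm_coe]

lemma poissonKernel_circle_nonneg {ρ : ℝ} (h0 : 0 ≤ ρ) (h1 : ρ < 1) (t : Circle) :
    0 ≤ poissonKernel 0 (ρ : ℂ) (t : ℂ) := by
  rw [poissonKernel_circle]
  have : 0 ≤ 1 - ρ ^ 2 := by nlinarith
  positivity

lemma continuous_circle_coe : Continuous fun t : Circle => (t : ℂ) :=
  continuous_induced_dom

lemma measurable_circle_coe : Measurable fun t : Circle => (t : ℂ) :=
  continuous_circle_coe.measurable

lemma measurable_poissonKernel_circle (ρ : ℝ) :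
    Measurable fun t : Circle => poissonKernel 0 (ρ : ℂ) (t : ℂ) := by
  simp_rw [poissonKernel_circle]
  exact measurable_const.div ((measurable_circle_coe.sub_const _).norm.pow_const 2)

lemma measurable_poissonDensity (ρ : ℝ) : Measurable fun t : Circle =>
    ENNReal.ofReal ((2 * Real.pi)⁻¹ * poissonKernel 0 (ρ : ℂ) (t : ℂ)) :=
  ((measurable_poissonKernel_circle ρ).const_mul _).ennreal_ofReal

/-- The Poisson integral formula: the value at `ρ x` is the average over the rotates of `x`. -/
lemma integral_poissonMeasure {f : ℂ → ℂ} (hf : DiffContOnCl ℂ f (Metric.ball 0 1))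
    {ρ : ℝ} (h0 : 0 ≤ ρ) (h1 : ρ < 1) (x : Circle) :
    ∫ t : Circle, f ((x * t : Circle) : ℂ) ∂poissonMeasure ρ = f ((ρ : ℂ) * x) := by
  have hmaps : MapsTo (fun z : ℂ => (x : ℂ) * z) (Metric.ball 0 1) (Metric.ball 0 1) := by
    intro z hz
    simpa [Circle.norm_coe] using hz
  have hg : DiffContOnCl ℂ (fun z => f ((x : ℂ) * z)) (Metric.ball 0 1) :=
    hf.comp (DifferentiableOn.diffContOnCl (by fun_prop)) hmaps
  have hw : (ρ : ℂ) ∈ Metric.ball (0 : ℂ) 1 := by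
    simpa [abs_of_nonneg h0] using h1
  have hcont : Continuous fun t : Circle => f ((x : ℂ) * t) := by
    have hc := hg.continuousOn
    rw [closure_ball (0 : ℂ) one_ne_zero] at hc
    exact hc.comp_continuous continuous_circle_coe fun t => by
      simp [Circle.norm_coe]
  have key := hg.circleAverage_poissonKernel_smul hw
  rw [circleAverage_eq_integral_arcLength] at key
  · rw [poissonMeasure, integral_withDensity_eq_integral_toReal_smul
      (measurable_poissonDensity ρ) (ae_of_all _ fun _ => ENNReal.ofReal_lt_top)]
    rw [mul_comm (ρ : ℂ) (x : ℂ), ← key, ← integral_smul]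
    refine integral_congr_ae (ae_of_all _ fun t => ?_)
    have := poissonKernel_circle_nonneg h0 h1 t
    simp only [Pi.smul_apply']
    rw [ENNReal.toReal_ofReal (by positivity), Circle.coe_mul, smul_smul]
  · exact (measurable_poissonKernel_circle ρ).smul hcont.measurable

lemma isProbabilityMeasure_poissonMeasure {ρ : ℝ} (h0 : 0 ≤ ρ) (h1 : ρ < 1) :
    IsProbabilityMeasure (poissonMeasure ρ) := by
  -- the total mass is the Poisson average of the constant function `1`
  have h := integral_poissonMeasure (f := fun _ => (1 : ℂ)) diffContOnCl_const h0 h1 1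
  rw [integral_const, Complex.real_smul, mul_one, Complex.ofReal_eq_one] at h
  exact ⟨(ENNReal.toReal_eq_one_iff _).1 h⟩

/-- Jensen's inequality for a probability measure and the function `|·| ^ p`. -/
lemma enorm_integral_rpow_le {α : Type*} [MeasurableSpace α] {ν : Measure α}
    [IsProbabilityMeasure ν] {h : α → ℂ} (hh : AEStronglyMeasurable h ν) {p : ℝ} (hp : 1 ≤ p) :
    ‖∫ t, h t ∂ν‖ₑ ^ p ≤ ∫⁻ t, ‖h t‖ₑ ^ p ∂ν := by
  have hp0 : 0 < p := by linarith
  have h1 : ‖∫ t, h t ∂ν‖ₑ ≤ eLpNorm h (ENNReal.ofReal p) ν := by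
    refine (enorm_integral_le_lintegral_enorm h).trans ?_
    rw [← eLpNorm_one_eq_lintegral_enorm]
    exact eLpNorm_le_eLpNorm_of_exponent_le (by simpa using hp) hh
  rw [eLpNorm_eq_lintegral_rpow_enorm_toReal (by simpa using hp0) ENNReal.ofReal_ne_top,
    ENNReal.toReal_ofReal hp0.le] at h1
  calc _ ≤ _ := ENNReal.rpow_le_rpow h1 hp0.le
    _ = _ := by rw [← ENNReal.rpow_mul, one_div_mul_cancel hp0.ne', ENNReal.rpow_one]

/-! ### The Gagliardo energy -/

/-- The difference quotient `|g x - g y| ^ p / |x - y| ^ (1 + s p)`, with value `0` on the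
diagonal. -/
noncomputable def gagliardoQuotient (s p : ℝ) (g : Circle → ℂ) (x y : Circle) : ℝ≥0∞ :=
  ‖g x - g y‖ₑ ^ p / ‖(x : ℂ) - (y : ℂ)‖ₑ ^ (1 + s * p)

/-- The `p`-th power of the Gagliardo seminorm, as an integral over the torus. -/
noncomputable def gagliardoEnergy (s p : ℝ) (g : Circle → ℂ) : ℝ≥0∞ :=
  ∫⁻ z, gagliardoQuotient s p g z.1 z.2 ∂(arcLength.prod arcLength)

lemma measurable_gagliardoQuotient {s p : ℝ} {g : Circle → ℂ} (hg : Measurable g) :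
    Measurable fun z : Circle × Circle => gagliardoQuotient s p g z.1 z.2 := by
  unfold gagliardoQuotient
  refine Measurable.div ?_ ?_
  · exact (((hg.comp measurable_fst).sub (hg.comp measurable_snd)).enorm).pow_const p
  · exact (((measurable_circle_coe.comp measurable_fst).sub
      (measurable_circle_coe.comp measurable_snd)).enorm).pow_const _

lemma gagliardoSeminorm_eq {s p : ℝ} {g : Circle → ℂ} (hg : Measurable g) :
    gagliardoSeminorm s p g = gagliardoEnergy s p g ^ (1 / p) := by
  rw [gagliardoEnergy, arcLength, Measure.map_prod_map _ _ measurable_circleExp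
    measurable_circleExp, lintegral_map (measurable_gagliardoQuotient hg)
    (measurable_circleExp.prodMap measurable_circleExp), Measure.prod_restrict]
  rfl

lemma gagliardoQuotient_mul_right (s p : ℝ) (g : Circle → ℂ) (x y t : Circle) :
    gagliardoQuotient s p g (x * t) (y * t) =
      gagliardoQuotient s p (fun x => g (x * t)) x y := by
  have h : ‖((x * t : Circle) : ℂ) - ((y * t : Circle) : ℂ)‖ₑ = ‖(x : ℂ) - (y : ℂ)‖ₑ := by
    rw [Circle.coe_mul, Circle.coe_mul, ← sub_mul, enorm_mul,
      ← ofReal_norm (t : ℂ), Circle.norm_coe, ENNReal.ofReal_one, mul_one]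
  simp only [gagliardoQuotient, h]

lemma gagliardoEnergy_rotate (s p : ℝ) (g : Circle → ℂ) (t : Circle) :
    gagliardoEnergy s p (fun x => g (x * t)) = gagliardoEnergy s p g := by
  simp_rw [gagliardoEnergy, ← gagliardoQuotient_mul_right]
  simp_rw [mul_comm _ t]
  exact lintegral_mul_left_eq_self (μ := arcLength.prod arcLength)
    (fun z => gagliardoQuotient s p g z.1 z.2) (t, t)

/-- Averaging over rotations does not increase the Gagliardo energy: it is convex and
rotation invariant. -/
lemma gagliardoEnergy_average_le {s p : ℝ} (hp : 1 ≤ p) {g h : Circle → ℂ} (hg : Measurable g)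
    {ν : Measure Circle} [IsProbabilityMeasure ν]
    (hint : ∀ x, Integrable (fun t => g (x * t)) ν)
    (hh : ∀ x, ∫ t, g (x * t) ∂ν = h x) :
    gagliardoEnergy s p h ≤ gagliardoEnergy s p g := by
  have hmeas : Measurable fun w : (Circle × Circle) × Circle =>
      gagliardoQuotient s p (fun x => g (x * w.2)) w.1.1 w.1.2 := by
    have hφ : Measurable fun w : (Circle × Circle) × Circle =>
        ((w.1.1 * w.2, w.1.2 * w.2) : Circle × Circle) := by fun_prop
    have heq : (fun w : (Circle × Circle) × Circle =>
        gagliardoQuotient s p (fun x => g (x * w.2)) w.1.1 w.1.2) =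
        (fun z : Circle × Circle => gagliardoQuotient s p g z.1 z.2) ∘
          fun w => (w.1.1 * w.2, w.1.2 * w.2) :=
      funext fun w => (gagliardoQuotient_mul_right s p g w.1.1 w.1.2 w.2).symm
    rw [heq]
    exact (measurable_gagliardoQuotient hg).comp hφ
  have hpt (z : Circle × Circle) : gagliardoQuotient s p h z.1 z.2 ≤
      ∫⁻ t, gagliardoQuotient s p (fun x => g (x * t)) z.1 z.2 ∂ν := by
    simp only [gagliardoQuotient, ENNReal.div_eq_inv_mul]
    rw [lintegral_const_mul]
    · gcongr
      rw [← hh, ← hh, ← integral_sub (hint _) (hint _)]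
      exact enorm_integral_rpow_le ((hint _).sub (hint _)).aestronglyMeasurable hp
    · exact (((hg.comp (measurable_const_mul _)).sub
        (hg.comp (measurable_const_mul _))).enorm).pow_const p
  calc gagliardoEnergy s p h
      ≤ ∫⁻ z, ∫⁻ t, gagliardoQuotient s p (fun x => g (x * t)) z.1 z.2 ∂ν
          ∂(arcLength.prod arcLength) := lintegral_mono hpt
    _ = ∫⁻ t, gagliardoEnergy s p (fun x => g (x * t)) ∂ν :=
        lintegral_lintegral_swap hmeas.aemeasurable
    _ = gagliardoEnergy s p g := by simp [gagliardoEnergy_rotate]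

/-! ### The rate of approximation by Poisson averages -/

/-- The bound for the Poisson kernel times the chord length to the power `1 + q`; it tends to `0`
as `ρ → 1`. -/
noncomputable def poissonRate (q ρ : ℝ) : ℝ := 2 ^ (2 + q) * (1 - ρ) ^ min 1 q

/-- Both `1 - ρ` and half the chord `|t - 1|` are at most `|t - ρ|`; so the chord length
compensates the singularity of the kernel, and a power of `1 - ρ` is gained. -/
lemma poissonKernel_mul_chord_rpow_le {q ρ : ℝ} (hq : 0 < q) (h0 : 0 ≤ ρ) (h1 : ρ < 1)
    (t : Circle) :
    poissonKernel 0 (ρ : ℂ) (t : ℂ) * ‖(1 : ℂ) - (t : ℂ)‖ ^ (1 + q) ≤ poissonRate q ρ := by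
  rw [poissonKernel_circle, poissonRate]
  set m := ‖(t : ℂ) - ρ‖
  set d := ‖(1 : ℂ) - (t : ℂ)‖
  set β := min 1 q
  have ha : 0 < 1 - ρ := by linarith
  have hβ0 : 0 < β := lt_min one_pos hq
  have hβ1 : β ≤ 1 := min_le_left _ _
  have hβq : β ≤ q := min_le_right _ _
  have hm : 1 - ρ ≤ m := by
    have := norm_sub_norm_le (t : ℂ) (ρ : ℂ)
    rwa [Circle.norm_coe, Complex.norm_real, Real.norm_of_nonneg h0] at this
  have hρ : ‖(1 : ℂ) - ρ‖ = 1 - ρ := by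
    rw [← Complex.ofReal_one, ← Complex.ofReal_sub, Complex.norm_real,
      Real.norm_of_nonneg ha.le]
  have hdm : d ≤ 2 * m := by
    have h3 : d ≤ ‖(1 : ℂ) - ρ‖ + ‖(ρ : ℂ) - t‖ := norm_sub_le_norm_sub_add_norm_sub _ _ _
    rw [hρ, norm_sub_rev (ρ : ℂ)] at h3
    linarith
  have hd0 : 0 ≤ d := norm_nonneg _
  have hd2 : d ≤ 2 := by
    have := norm_sub_le (1 : ℂ) (t : ℂ)
    rw [Circle.norm_coe, norm_one] at this
    linarith
  have hm0 : 0 < m := ha.trans_le hm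
  -- spend `1 + β ≤ 2` powers of `d` on the kernel and bound the remaining ones by `d ≤ 2`
  have e1 : d ^ (1 + q) ≤ (2 * m) ^ (1 + β) * 2 ^ (q - β) := by
    have : d ^ (1 + q) = d ^ (1 + β) * d ^ (q - β) := by
      rw [← Real.rpow_add_of_nonneg hd0 (by linarith) (by linarith)]
      congr 1; ring
    rw [this]
    gcongr
  have e2 : (2 * m) ^ (1 + β) * 2 ^ (q - β) = 2 ^ (1 + q) * (m ^ 2 * m ^ (β - 1)) := by
    rw [Real.mul_rpow two_pos.le hm0.le, mul_right_comm, ← Real.rpow_add two_pos,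
      ← Real.rpow_natCast m 2, ← Real.rpow_add hm0]
    congr 2 <;> push_cast <;> ring
  have e3 : m ^ (β - 1) ≤ (1 - ρ) ^ (β - 1) :=
    Real.rpow_le_rpow_of_nonpos ha hm (by linarith)
  have e4 : 1 - ρ ^ 2 ≤ 2 * (1 - ρ) := by nlinarith
  have e5 : 0 ≤ 1 - ρ ^ 2 := by nlinarith
  calc (1 - ρ ^ 2) / m ^ 2 * d ^ (1 + q)
      ≤ (2 * (1 - ρ)) / m ^ 2 * (2 ^ (1 + q) * (m ^ 2 * (1 - ρ) ^ (β - 1))) := by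
        have := e1.trans_eq e2
        gcongr
        exact this.trans (by gcongr)
    _ = 2 ^ (2 + q) * (1 - ρ) ^ β := by
        have h5 : (1 - ρ) ^ β = (1 - ρ) ^ (β - 1) * (1 - ρ) := by
          rw [← Real.rpow_add_one ha.ne']; congr 1; ring
        have h6 : (2 : ℝ) ^ (2 + q) = 2 ^ (1 + q) * 2 := by
          rw [← Real.rpow_add_one two_ne_zero]; congr 1; ring
        rw [h5, h6]
        field_simp

/-- The Poisson average of `f` differs from `f` at `x` by at most the rate times the part of the
Gagliardo energy at `x`. With `ρ = 0` this is a Poincaré inequality. -/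
lemma enorm_poisson_sub_rpow_le {s p : ℝ} (hs : 0 < s) (hp : 1 < p) {f : ℂ → ℂ}
    (hf : DiffContOnCl ℂ f (Metric.ball 0 1)) {ρ : ℝ} (h0 : 0 ≤ ρ) (h1 : ρ < 1) (x : Circle) :
    ‖f ((ρ : ℂ) * x) - f x‖ₑ ^ p ≤ ENNReal.ofReal (poissonRate (s * p) ρ) *
      ∫⁻ y, gagliardoQuotient s p (fun y : Circle => f y) x y ∂arcLength := by
  have hp0 : 0 < p := by linarith
  have := isProbabilityMeasure_poissonMeasure h0 h1
  have hcont : Continuous fun t : Circle => f t := by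
    have hc := hf.continuousOn
    rw [closure_ball (0 : ℂ) one_ne_zero] at hc
    exact hc.comp_continuous continuous_circle_coe fun t => by simp [Circle.norm_coe]
  have hcont' : Continuous fun t : Circle => f ((x * t : Circle) : ℂ) :=
    hcont.comp (continuous_const_mul x)
  have hrep : f ((ρ : ℂ) * x) - f x =
      ∫ t : Circle, (f ((x * t : Circle) : ℂ) - f x) ∂poissonMeasure ρ := by
    rw [integral_sub (hcont'.integrable_of_hasCompactSupport
      (HasCompactSupport.of_compactSpace _)) (integrable_const _),
      integral_poissonMeasure hf h0 h1]
    simp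
  rw [hrep]
  have hm : Measurable fun t : Circle => ‖f ((x * t : Circle) : ℂ) - f x‖ₑ ^ p :=
    (hcont'.sub continuous_const).measurable.enorm.pow_const p
  refine (enorm_integral_rpow_le
    (h := fun t : Circle => f ((x * t : Circle) : ℂ) - f x)
    (hcont'.sub continuous_const).aestronglyMeasurable hp.le).trans ?_
  rw [← lintegral_mul_left_eq_self (μ := arcLength) _ x,
    ← lintegral_const_mul' _ _ ENNReal.ofReal_ne_top,
    poissonMeasure, lintegral_withDensity_eq_lintegral_mul _ (measurable_poissonDensity ρ) hm]
  refine lintegral_mono fun t => ?_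
  simp only [Pi.mul_apply, gagliardoQuotient]
  rw [← enorm_neg (f x - _), neg_sub]
  have hd : ‖(x : ℂ) - ((x * t : Circle) : ℂ)‖ = ‖(1 : ℂ) - t‖ := by
    rw [Circle.coe_mul, ← mul_one_sub, norm_mul, Circle.norm_coe, one_mul]
  -- at `t = 1` both sides vanish, the quotient being `0 / 0`
  rcases eq_or_ne t 1 with rfl | ht
  · simp [hp0]
  have hpos : 0 < ‖(1 : ℂ) - t‖ := by
    rw [norm_pos_iff, sub_ne_zero]
    exact fun h => ht (Circle.ext (by simpa using h.symm))
  rw [← ofReal_norm ((x : ℂ) - _), hd,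
    ENNReal.ofReal_rpow_of_pos hpos, ENNReal.div_eq_inv_mul, ← mul_assoc]
  gcongr
  rw [← ENNReal.div_eq_inv_mul.trans (mul_comm _ _),
    ← ENNReal.ofReal_div_of_pos (by positivity)]
  refine ENNReal.ofReal_le_ofReal ?_
  rw [le_div_iff₀ (by positivity), mul_assoc]
  have hk := poissonKernel_mul_chord_rpow_le (mul_pos hs hp0) h0 h1 t
  have hk0 := poissonKernel_circle_nonneg h0 h1 t
  refine (mul_le_of_le_one_left (by positivity) (inv_le_one_of_one_le₀ ?_)).trans hk
  linarith [Real.pi_gt_three]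

/-! ### Lipschitz functions and radial restrictions -/

/-- A chord is at least `2 / π` times its arc. -/
lemma norm_one_sub_circleExp_ge {θ : ℝ} (hθ : |θ| ≤ Real.pi) :
    2 / Real.pi * |θ| ≤ ‖(1 : ℂ) - (Circle.exp θ : ℂ)‖ := by
  have h := Real.mul_abs_le_abs_sin (x := θ / 2) (by
    rw [abs_div, abs_two]; linarith)
  rw [norm_sub_rev, Circle.coe_exp, mul_comm (θ : ℂ), Complex.norm_exp_I_mul_ofReal_sub_one,
    norm_mul, Real.norm_eq_abs, Real.norm_eq_abs, abs_two]
  rw [abs_div, abs_two] at h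
  linarith

lemma integrableOn_abs_rpow {a : ℝ} (ha : -1 < a) {b : ℝ} (hb : 0 < b) :
    IntegrableOn (fun θ : ℝ => |θ| ^ a) (Ioc (-b) b) := by
  have h1 : IntervalIntegrable (fun x : ℝ => x ^ a) volume 0 b :=
    intervalIntegral.intervalIntegrable_rpow' ha
  have h2 : IntervalIntegrable (fun x : ℝ => |x| ^ a) volume 0 b := by
    refine h1.congr fun x hx => ?_
    rw [uIoc_of_le hb.le] at hx
    simp only [abs_of_pos hx.1]
  have h3 : IntervalIntegrable (fun x : ℝ => |x| ^ a) volume (-b) 0 := by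
    rw [IntervalIntegrable.iff_comp_neg]
    simpa using h2.symm
  exact (intervalIntegrable_iff_integrableOn_Ioc_of_le (by linarith)).1 (h3.trans h2)

lemma lintegral_chord_rpow_lt_top {a : ℝ} (ha : -1 < a) :
    ∫⁻ t : Circle, ENNReal.ofReal (‖(1 : ℂ) - (t : ℂ)‖ ^ a) ∂arcLength < ⊤ := by
  have hd2 (t : Circle) : ‖(1 : ℂ) - (t : ℂ)‖ ≤ 2 := by
    have := norm_sub_le (1 : ℂ) (t : ℂ)
    rw [Circle.norm_coe, norm_one] at this
    linarith
  rcases le_or_gt 0 a with h | h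
  · calc _ ≤ ∫⁻ _ : Circle, ENNReal.ofReal (2 ^ a) ∂arcLength := by
          refine lintegral_mono fun t => ENNReal.ofReal_le_ofReal ?_
          exact Real.rpow_le_rpow (norm_nonneg _) (hd2 t) h
      _ < ⊤ := by
          rw [lintegral_const]
          exact ENNReal.mul_lt_top ENNReal.ofReal_lt_top (measure_lt_top _ _)
  · have hm : Measurable fun t : Circle => ENNReal.ofReal (‖(1 : ℂ) - (t : ℂ)‖ ^ a) :=
      (((measurable_circle_coe.const_sub 1).norm).pow_const a).ennreal_ofReal
    rw [lintegral_arcLength hm (-Real.pi),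
      show -Real.pi + 2 * Real.pi = Real.pi by ring]
    refine lt_of_le_of_lt (lintegral_mono_ae ?_)
      (((integrableOn_abs_rpow ha Real.pi_pos).const_mul
        ((2 / Real.pi) ^ a)).lintegral_lt_top)
    -- the negative power takes the junk value `0` at `θ = 0` only
    have h0 : ∀ᵐ θ : ℝ ∂volume.restrict (Ioc (-Real.pi) Real.pi), θ ≠ 0 :=
      ae_restrict_of_ae (by simp [ae_iff])
    filter_upwards [h0, ae_restrict_mem measurableSet_Ioc] with θ hθ0 hθ
    have hθ0' : 0 < |θ| := abs_pos.2 hθ0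
    have := Real.pi_pos
    rw [← Real.mul_rpow (by positivity) (abs_nonneg _)]
    exact ENNReal.ofReal_le_ofReal (Real.rpow_le_rpow_of_nonpos (by positivity)
      (norm_one_sub_circleExp_ge (abs_le.2 ⟨hθ.1.le, hθ.2⟩)) h.le)

/-- Lipschitz functions have finite energy, since the exponent `p - 1 - s p` of the chord length
exceeds `-1`. -/
lemma gagliardoEnergy_lt_top_of_lipschitz {s p : ℝ} (hs1 : s < 1) (hp : 0 < p)
    {g : Circle → ℂ} {K : ℝ} (hg : ∀ x y : Circle, ‖g x - g y‖ ≤ K * ‖(x : ℂ) - y‖) :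
    gagliardoEnergy s p g < ⊤ := by
  set a := p - (1 + s * p)
  have ha : -1 < a := by simp only [a]; nlinarith
  have hK : 0 ≤ K := by
    by_contra! h
    have h2 := (norm_nonneg _).trans (hg 1 (-1))
    have : (0 : ℝ) < ‖((1 : Circle) : ℂ) - ((-1 : Circle) : ℂ)‖ := by
      simp only [Circle.coe_neg, Circle.coe_one]; norm_num
    nlinarith
  have hpt (x y : Circle) : gagliardoQuotient s p g x y ≤
      ENNReal.ofReal (K ^ p) * ENNReal.ofReal (‖(x : ℂ) - y‖ ^ a) := by
    rcases eq_or_ne x y with rfl | hxy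
    · simp [gagliardoQuotient, hp]
    have hpos : 0 < ‖(x : ℂ) - y‖ := by
      rw [norm_pos_iff, sub_ne_zero]
      exact fun h => hxy (Circle.ext h)
    rw [gagliardoQuotient, ← ofReal_norm, ← ofReal_norm, ENNReal.ofReal_rpow_of_pos hpos,
      ENNReal.ofReal_rpow_of_nonneg (norm_nonneg _) hp.le,
      ← ENNReal.ofReal_div_of_pos (by positivity), ← ENNReal.ofReal_mul (by positivity)]
    refine ENNReal.ofReal_le_ofReal ?_
    rw [Real.rpow_sub hpos, ← mul_div_assoc, ← Real.mul_rpow hK hpos.le]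
    gcongr
    exact hg x y
  have hm : Measurable fun z : Circle × Circle => ENNReal.ofReal (‖(z.1 : ℂ) - z.2‖ ^ a) :=
    ((((measurable_circle_coe.comp measurable_fst).sub
      (measurable_circle_coe.comp measurable_snd)).norm).pow_const a).ennreal_ofReal
  have hin (x : Circle) : ∫⁻ y : Circle, ENNReal.ofReal (‖(x : ℂ) - y‖ ^ a) ∂arcLength =
      ∫⁻ t : Circle, ENNReal.ofReal (‖(1 : ℂ) - t‖ ^ a) ∂arcLength := by
    rw [← lintegral_mul_left_eq_self (μ := arcLength) _ x]
    congr 1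
    ext t
    rw [Circle.coe_mul, ← mul_one_sub, norm_mul, Circle.norm_coe, one_mul]
  calc gagliardoEnergy s p g
      ≤ ∫⁻ z : Circle × Circle, ENNReal.ofReal (K ^ p) *
          ENNReal.ofReal (‖(z.1 : ℂ) - z.2‖ ^ a) ∂(arcLength.prod arcLength) :=
        lintegral_mono fun z => hpt z.1 z.2
    _ = ENNReal.ofReal (K ^ p) * ((∫⁻ t : Circle, ENNReal.ofReal (‖(1 : ℂ) - t‖ ^ a)
          ∂arcLength) * arcLength univ) := by
        rw [lintegral_const_mul _ hm, lintegral_prod _ hm.aemeasurable]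
        simp only [hin, lintegral_const]
    _ < ⊤ := ENNReal.mul_lt_top ENNReal.ofReal_lt_top
        (ENNReal.mul_lt_top (lintegral_chord_rpow_lt_top ha) (measure_lt_top _ _))

lemma mul_circle_mem_ball {r : ℝ} (h0 : 0 ≤ r) (h1 : r < 1) (x : Circle) :
    (r : ℂ) * x ∈ Metric.ball (0 : ℂ) 1 := by
  simpa [Circle.norm_coe, abs_of_nonneg h0] using h1

lemma contMDiff_radialRestriction {u : ℂ → ℂ} (hu : AnalyticOnNhd ℂ u (Metric.ball 0 1)) {r : ℝ}
    (h0 : 0 ≤ r) (h1 : r < 1) : ContMDiff (𝓡 1) 𝓘(ℝ, ℂ) ∞ (radialRestriction u r) := by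
  intro x
  have h2 : ContDiffAt ℝ ∞ (fun z : ℂ => u ((r : ℂ) * z)) (x : ℂ) := by
    have h3 : ContDiffAt ℝ ∞ u ((r : ℂ) * x) :=
      ((hu _ (mul_circle_mem_ball h0 h1 x)).contDiffAt).restrict_scalars ℝ
    exact h3.comp (x : ℂ) (contDiff_const.mul contDiff_id).contDiffAt
  have := finrank_real_complex_fact'
  exact h2.contMDiffAt.comp x (contMDiff_coe_sphere (E := ℂ) (n := 1)).contMDiffAt

lemma continuous_radialRestriction {u : ℂ → ℂ} (hu : AnalyticOnNhd ℂ u (Metric.ball 0 1)) {r : ℝ}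
    (h0 : 0 ≤ r) (h1 : r < 1) : Continuous (radialRestriction u r) :=
  (contMDiff_radialRestriction hu h0 h1).continuous

lemma exists_lipschitz_radialRestriction {u : ℂ → ℂ}
    (hu : AnalyticOnNhd ℂ u (Metric.ball 0 1)) {r : ℝ} (h0 : 0 ≤ r) (h1 : r < 1) :
    ∃ K : ℝ, ∀ x y : Circle,
      ‖radialRestriction u r x - radialRestriction u r y‖ ≤ K * ‖(x : ℂ) - y‖ := by
  have hsub : Metric.closedBall (0 : ℂ) r ⊆ Metric.ball 0 1 :=
    Metric.closedBall_subset_ball h1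
  have hc : ContDiffOn ℝ 1 u (Metric.closedBall 0 r) := fun z hz =>
    (((hu z (hsub hz)).contDiffAt (n := 1)).restrict_scalars ℝ).contDiffWithinAt
  obtain ⟨K, hK⟩ := hc.exists_lipschitzOnWith one_ne_zero (convex_closedBall _ _)
    (isCompact_closedBall _ _)
  have hmem (x : Circle) : (r : ℂ) * x ∈ Metric.closedBall (0 : ℂ) r := by
    simp [Circle.norm_coe, abs_of_nonneg h0]
  refine ⟨K * r, fun x y => (hK.norm_sub_le (hmem x) (hmem y)).trans_eq ?_⟩
  rw [← mul_sub, norm_mul, Complex.norm_real, Real.norm_of_nonneg h0, mul_assoc]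

lemma memLpCircle_of_continuous {g : Circle → ℂ} (hg : Continuous g) (p : ℝ) :
    MemLpCircle p g := by
  obtain ⟨C, hC⟩ := (isCompact_range hg).isBounded.exists_norm_le
  exact MemLp.of_bound hg.aestronglyMeasurable C (ae_of_all _ fun x => hC _ ⟨x, rfl⟩)

lemma memFracSobolev_radialRestriction {s p : ℝ} (hs1 : s < 1) (hp : 0 < p) {u : ℂ → ℂ}
    (hu : AnalyticOnNhd ℂ u (Metric.ball 0 1)) {r : ℝ} (h0 : 0 ≤ r) (h1 : r < 1) :
    MemFracSobolev s p (radialRestriction u r) := by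
  have hc := continuous_radialRestriction hu h0 h1
  obtain ⟨K, hK⟩ := exists_lipschitz_radialRestriction hu h0 h1
  refine ⟨memLpCircle_of_continuous hc p, ?_⟩
  rw [gagliardoSeminorm_eq hc.measurable]
  exact ENNReal.rpow_lt_top_of_nonneg (by positivity)
    (gagliardoEnergy_lt_top_of_lipschitz hs1 hp hK).ne

/-! ### A Riesz–Scheffé lemma -/

/-- If nonnegative functions converge almost everywhere and their integrals do not exceed that of
the limit, then quantities dominated by them and tending to `0` have integrals tending to `0`.
The proof applies Fatou's lemma to the difference of the dominating and the dominated functions. -/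
lemma tendsto_lintegral_zero_of_le_add {ι α : Type*} [MeasurableSpace α] {ν : Measure α}
    {l : Filter ι} [l.NeBot] [l.IsCountablyGenerated] {D A : ι → α → ℝ≥0∞} {A₀ : α → ℝ≥0∞}
    {K : ℝ≥0∞} (hK : K ≠ ⊤) (hDm : ∀ i, Measurable (D i)) (hAm : ∀ i, Measurable (A i))
    (hA₀m : Measurable A₀) (hD : ∀ i z, D i z ≤ K * (A i z + A₀ z))
    (hD0 : ∀ᵐ z ∂ν, Tendsto (fun i => D i z) l (𝓝 0))
    (hA : ∀ᵐ z ∂ν, Tendsto (fun i => A i z) l (𝓝 (A₀ z)))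
    (hle : ∀ᶠ i in l, ∫⁻ z, A i z ∂ν ≤ ∫⁻ z, A₀ z ∂ν) (hfin : ∫⁻ z, A₀ z ∂ν ≠ ⊤) :
    Tendsto (fun i => ∫⁻ z, D i z ∂ν) l (𝓝 0) := by
  set c := K * (∫⁻ z, A₀ z ∂ν + ∫⁻ z, A₀ z ∂ν)
  have hc : c ≠ ⊤ := ENNReal.mul_ne_top hK (ENNReal.add_ne_top.2 ⟨hfin, hfin⟩)
  have hsum (i) : ∫⁻ z, K * (A i z + A₀ z) ∂ν = K * (∫⁻ z, A i z ∂ν + ∫⁻ z, A₀ z ∂ν) := by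
    rw [lintegral_const_mul' _ _ hK, lintegral_add_left (hAm i)]
  have hmul {a : ℝ≥0∞} (ha : a ≤ ∫⁻ z, A₀ z ∂ν) : K * (a + ∫⁻ z, A₀ z ∂ν) ≤ c := by
    simp only [c]
    gcongr
  have hDc : ∀ᶠ i in l, ∫⁻ z, D i z ∂ν ≤ c := by
    filter_upwards [hle] with i hi
    exact (lintegral_mono (hD i)).trans ((hsum i).trans_le (hmul hi))
  have key : c ≤ c - limsup (fun i => ∫⁻ z, D i z ∂ν) l := by
    calc c = ∫⁻ z, K * (A₀ z + A₀ z) ∂ν := by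
          rw [lintegral_const_mul' _ _ hK, lintegral_add_left hA₀m]
      _ = ∫⁻ z, liminf (fun i => K * (A i z + A₀ z) - D i z) l ∂ν := by
          refine lintegral_congr_ae ?_
          filter_upwards [hD0, hA] with z hz0 hz
          have h1 := ENNReal.Tendsto.sub (ENNReal.Tendsto.const_mul (a := K)
            (hz.add (tendsto_const_nhds (x := A₀ z))) (Or.inr hK)) hz0 (Or.inr ENNReal.zero_ne_top)
          rw [tsub_zero] at h1
          exact h1.liminf_eq.symm
      _ ≤ liminf (fun i => ∫⁻ z, K * (A i z + A₀ z) - D i z ∂ν) l :=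
          lintegral_liminf_le fun i => (((hAm i).add hA₀m).const_mul K).sub (hDm i)
      _ ≤ liminf (fun i => c - ∫⁻ z, D i z ∂ν) l := by
          refine liminf_le_liminf ?_
          filter_upwards [hle, hDc] with i hi hic
          rw [lintegral_sub (hDm i) (ne_top_of_le_ne_top hc hic) (ae_of_all _ (hD i)), hsum i]
          exact tsub_le_tsub_right (hmul hi) _
      _ = c - limsup (fun i => ∫⁻ z, D i z ∂ν) l := ENNReal.liminf_const_sub l _ hc
  have hLc : limsup (fun i => ∫⁻ z, D i z ∂ν) l ≤ c := limsup_le_of_le (by isBoundedDefault) hDc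
  have hL : limsup (fun i => ∫⁻ z, D i z ∂ν) l = 0 := by
    have h1 := add_le_of_le_tsub_right_of_le hLc key
    refine nonpos_iff_eq_zero.1 ((ENNReal.add_le_add_iff_left hc).1 ?_)
    rwa [add_zero]
  exact tendsto_of_le_liminf_of_limsup_le zero_le hL.le

/-! ### Estimates on concentric circles -/

section Radial

variable {s p : ℝ} {u : ℂ → ℂ}

/-- The contribution of the point `x` to the Gagliardo energy. -/
noncomputable def gagliardoDensity (s p : ℝ) (g : Circle → ℂ) (x : Circle) : ℝ≥0∞ :=
  ∫⁻ y, gagliardoQuotient s p g x y ∂arcLength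

lemma measurable_gagliardoDensity {g : Circle → ℂ} (hg : Measurable g) :
    Measurable (gagliardoDensity s p g) :=
  (measurable_gagliardoQuotient hg).lintegral_prod_right'

lemma lintegral_gagliardoDensity {g : Circle → ℂ} (hg : Measurable g) :
    ∫⁻ x, gagliardoDensity s p g x ∂arcLength = gagliardoEnergy s p g :=
  (lintegral_prod _ (measurable_gagliardoQuotient hg).aemeasurable).symm

lemma diffContOnCl_dilation (hu : AnalyticOnNhd ℂ u (Metric.ball 0 1)) {R : ℝ} (h0 : 0 ≤ R)
    (h1 : R < 1) : DiffContOnCl ℂ (fun z => u ((R : ℂ) * z)) (Metric.ball 0 1) := by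
  refine DifferentiableOn.diffContOnCl fun z hz => ?_
  rw [closure_ball (0 : ℂ) one_ne_zero, mem_closedBall_zero_iff] at hz
  have hmem : (R : ℂ) * z ∈ Metric.ball (0 : ℂ) 1 := by
    rw [mem_ball_zero_iff, norm_mul, Complex.norm_real, Real.norm_of_nonneg h0]
    nlinarith
  exact ((hu _ hmem).differentiableAt.comp z
    (differentiableAt_id.const_mul (R : ℂ))).differentiableWithinAt

lemma measurable_radialRestriction (hum : Measurable u) (r : ℝ) :
    Measurable (radialRestriction u r) :=
  hum.comp (measurable_circle_coe.const_mul _)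

lemma poissonRate_anti {q a b : ℝ} (hq : 0 < q) (hab : a ≤ b) (hb : b ≤ 1) :
    poissonRate q b ≤ poissonRate q a := by
  unfold poissonRate
  have : 0 < min 1 q := lt_min one_pos hq
  gcongr

lemma tendsto_poissonRate {q : ℝ} (hq : 0 < q) :
    Tendsto (fun r => ENNReal.ofReal (poissonRate q r)) (𝓝[<] 1) (𝓝 0) := by
  have hβ : 0 < min 1 q := lt_min one_pos hq
  have h1 : Tendsto (fun r : ℝ => 2 ^ (2 + q) * (1 - r) ^ min 1 q) (𝓝 1)
      (𝓝 (2 ^ (2 + q) * (1 - 1) ^ min 1 q)) := by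
    refine Tendsto.const_mul _ (Tendsto.rpow_const ?_ (Or.inr hβ.le))
    exact tendsto_const_nhds.sub tendsto_id
  rw [sub_self, Real.zero_rpow hβ.ne', mul_zero] at h1
  have h2 := ENNReal.tendsto_ofReal (h1.mono_left (nhdsWithin_le_nhds (s := Iio 1)))
  rwa [ENNReal.ofReal_zero] at h2

/-- Comparison of two concentric circles, `u_r` being a Poisson average of `u_R`. -/
lemma enorm_radialRestriction_sub_rpow_le (hs : 0 < s) (hp : 1 < p)
    (hu : AnalyticOnNhd ℂ u (Metric.ball 0 1)) {r R : ℝ} (h0 : 0 ≤ r) (hrR : r < R) (hR : R < 1)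
    (x : Circle) :
    ‖radialRestriction u r x - radialRestriction u R x‖ₑ ^ p ≤
      ENNReal.ofReal (poissonRate (s * p) r) * gagliardoDensity s p (radialRestriction u R) x := by
  have hR0 : 0 < R := h0.trans_lt hrR
  have h1 : r / R < 1 := (div_lt_one hR0).2 hrR
  have key := enorm_poisson_sub_rpow_le hs hp (diffContOnCl_dilation hu hR0.le hR)
    (div_nonneg h0 hR0.le) h1 x
  have e : (R : ℂ) * (((r / R : ℝ) : ℂ) * x) = r * x := by
    have : (R : ℂ) ≠ 0 := by exact_mod_cast hR0.ne'
    push_cast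
    field_simp
  rw [e] at key
  refine key.trans ?_
  have h2 : r ≤ r / R := by
    rw [le_div_iff₀ hR0]; nlinarith
  have h3 := poissonRate_anti (mul_pos hs (by linarith : 0 < p)) h2 h1.le
  exact mul_le_mul' (ENNReal.ofReal_le_ofReal h3) le_rfl

lemma Ioo_mem_nhdsLT_one {r : ℝ} (hr : r < 1) : Ioo r 1 ∈ 𝓝[<] (1 : ℝ) :=
  Ioo_mem_nhdsLT hr

/-- By Fatou's lemma `liminf G_R` is finite almost everywhere, where `G_R` is the
density of the energy of `u_R`; wherever it is finite, the comparison of concentric circles along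
radii `R → 1` at which `G_R` stays bounded makes the radial values a Cauchy family. -/
lemma ae_exists_radial_limit (hs : 0 < s) (hp : 1 < p)
    (hu : AnalyticOnNhd ℂ u (Metric.ball 0 1)) (hum : Measurable u) {S : ℝ≥0∞} (hS : S ≠ ⊤)
    (hE : ∀ r ∈ Ioo (0 : ℝ) 1, gagliardoEnergy s p (radialRestriction u r) ≤ S) :
    ∀ᵐ x ∂arcLength, ∃ w, Tendsto (fun r => radialRestriction u r x) (𝓝[<] 1) (𝓝 w) := by
  have hp0 : 0 < p := by linarith
  have hm (R : ℝ) := measurable_gagliardoDensity (s := s) (p := p)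
    (measurable_radialRestriction hum R)
  obtain ⟨a, ha⟩ := (𝓝[<] (1 : ℝ)).exists_seq_tendsto
  have hint : ∫⁻ x, liminf (fun n => gagliardoDensity s p (radialRestriction u (a n)) x) atTop
      ∂arcLength ≤ S := by
    refine (lintegral_liminf_le fun n => hm (a n)).trans (liminf_le_of_frequently_le'
      (Eventually.frequently ?_))
    filter_upwards [ha.eventually (Ioo_mem_nhdsLT_one one_pos)] with n hn
    rw [lintegral_gagliardoDensity (measurable_radialRestriction hum _)]
    exact hE _ hn
  filter_upwards [ae_lt_top (Measurable.liminf fun n => hm (a n))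
    (ne_top_of_le_ne_top hS hint)] with x hx
  rw [← cauchy_map_iff_exists_tendsto, EMetric.cauchy_iff]
  refine ⟨map_neBot.ne, fun ε hε => ?_⟩
  obtain ⟨M, hxM, hM⟩ := exists_between hx
  have hfreq := frequently_lt_of_liminf_lt (by isBoundedDefault) hxM
  -- the modulus of continuity `(rate(r) M) ^ (1 / p)`
  have hφ : Tendsto (fun r => (ENNReal.ofReal (poissonRate (s * p) r) * M) ^ (1 / p)) (𝓝[<] 1)
      (𝓝 0) := by
    have h1 := (ENNReal.Tendsto.mul_const (b := M) (tendsto_poissonRate (mul_pos hs hp0))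
      (Or.inr hM.ne)).ennrpow_const (1 / p)
    rwa [zero_mul, ENNReal.zero_rpow_of_pos (by positivity)] at h1
  have hev := (hφ.eventually (gt_mem_nhds (ENNReal.half_pos hε.ne'))).and
    (Ioo_mem_nhdsLT_one one_pos)
  refine ⟨_, image_mem_map hev, ?_⟩
  rintro _ ⟨r, ⟨hr, hr01⟩, rfl⟩ _ ⟨r', ⟨hr', hr01'⟩, rfl⟩
  obtain ⟨n, hRM, hR⟩ := (hfreq.and_eventually
    (ha.eventually (Ioo_mem_nhdsLT_one (max_lt hr01.2 hr01'.2)))).exists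
  set R := a n
  have hstep {t : ℝ} (ht0 : 0 ≤ t) (htR : t < R) :
      edist (radialRestriction u t x) (radialRestriction u R x) ≤
        (ENNReal.ofReal (poissonRate (s * p) t) * M) ^ (1 / p) := by
    rw [edist_eq_enorm_sub, one_div, ENNReal.le_rpow_inv_iff hp0]
    refine (enorm_radialRestriction_sub_rpow_le hs hp hu ht0 htR hR.2 x).trans ?_
    gcongr
  calc edist (radialRestriction u r x) (radialRestriction u r' x)
      ≤ edist (radialRestriction u r x) (radialRestriction u R x) +
          edist (radialRestriction u r' x) (radialRestriction u R x) :=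
        edist_triangle_right _ _ _
    _ < ε / 2 + ε / 2 := ENNReal.add_lt_add
        ((hstep hr01.1.le ((le_max_left _ _).trans_lt hR.1)).trans_lt hr)
        ((hstep hr01'.1.le ((le_max_right _ _).trans_lt hR.1)).trans_lt hr')
    _ = ε := ENNReal.add_halves ε

/-- Bound for the `p`-th power integrals on circles, from the Poincaré inequality. -/
lemma exists_lintegral_radialRestriction_le (hs : 0 < s) (hp : 1 < p)
    (hu : AnalyticOnNhd ℂ u (Metric.ball 0 1)) {S : ℝ≥0∞} (hS : S ≠ ⊤)
    (hE : ∀ r ∈ Ioo (0 : ℝ) 1, gagliardoEnergy s p (radialRestriction u r) ≤ S) :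
    ∃ B : ℝ≥0∞, B ≠ ⊤ ∧ ∀ r ∈ Ico (0 : ℝ) 1,
      ∫⁻ x, ‖radialRestriction u r x‖ₑ ^ p ∂arcLength ≤ B := by
  have hp0 : 0 < p := by linarith
  set K : ℝ≥0∞ := 2 ^ (p - 1)
  have hK : K ≠ ⊤ := ENNReal.rpow_ne_top_of_nonneg (by linarith) ENNReal.ofNat_ne_top
  refine ⟨K * (ENNReal.ofReal (poissonRate (s * p) 0) * S + ‖u 0‖ₑ ^ p * arcLength univ),
    ENNReal.mul_ne_top hK (ENNReal.add_ne_top.2 ⟨ENNReal.mul_ne_top ENNReal.ofReal_ne_top hS,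
      ENNReal.mul_ne_top (ENNReal.rpow_ne_top_of_nonneg hp0.le enorm_ne_top)
        (measure_ne_top _ _)⟩), fun r hr => ?_⟩
  have hc := continuous_radialRestriction hu hr.1 hr.2
  have hEr : gagliardoEnergy s p (radialRestriction u r) ≤ S := by
    rcases hr.1.eq_or_lt with rfl | h
    · -- on the circle of radius `0` the function is constant
      simp [gagliardoEnergy, gagliardoQuotient, radialRestriction, hp0]
    · exact hE r ⟨h, hr.2⟩
  have hpt (x : Circle) : ‖radialRestriction u r x‖ₑ ^ p ≤
      K * (ENNReal.ofReal (poissonRate (s * p) 0) *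
        gagliardoDensity s p (radialRestriction u r) x + ‖u 0‖ₑ ^ p) := by
    have h1 := enorm_poisson_sub_rpow_le hs hp (diffContOnCl_dilation hu hr.1 hr.2) le_rfl
      one_pos x
    rw [Complex.ofReal_zero, zero_mul, mul_zero] at h1
    have h2 : ‖radialRestriction u r x‖ₑ ≤ ‖u 0 - u ((r : ℂ) * x)‖ₑ + ‖u 0‖ₑ := by
      rw [← enorm_neg (u 0 - _), neg_sub]
      exact (congrArg _ (sub_add_cancel _ (u 0)).symm).trans_le (enorm_add_le _ _)
    calc _ ≤ (‖u 0 - u ((r : ℂ) * x)‖ₑ + ‖u 0‖ₑ) ^ p := by gcongr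
      _ ≤ K * (‖u 0 - u ((r : ℂ) * x)‖ₑ ^ p + ‖u 0‖ₑ ^ p) :=
        ENNReal.rpow_add_le_mul_rpow_add_rpow _ _ hp.le
      _ ≤ _ := by gcongr; exact h1
  have hm := measurable_gagliardoDensity (s := s) (p := p) hc.measurable
  refine (lintegral_mono hpt).trans ?_
  rw [lintegral_const_mul _ ((hm.const_mul _).add_const _),
    lintegral_add_left (hm.const_mul _), lintegral_const_mul _ hm,
    lintegral_gagliardoDensity hc.measurable, lintegral_const]
  gcongr

/-! ### The boundary function -/

/-- Fatou's lemma applied to the comparison of concentric circles. -/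
lemma lintegral_radialRestriction_sub_le (hs : 0 < s) (hp : 1 < p)
    (hu : AnalyticOnNhd ℂ u (Metric.ball 0 1)) (hum : Measurable u) {S : ℝ≥0∞}
    (hE : ∀ r ∈ Ioo (0 : ℝ) 1, gagliardoEnergy s p (radialRestriction u r) ≤ S)
    {v : Circle → ℂ}
    (hv : ∀ᵐ x ∂arcLength, Tendsto (fun r => radialRestriction u r x) (𝓝[<] 1) (𝓝 (v x)))
    {r : ℝ} (hr : r ∈ Ioo (0 : ℝ) 1) :
    ∫⁻ x, ‖radialRestriction u r x - v x‖ₑ ^ p ∂arcLength ≤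
      ENNReal.ofReal (poissonRate (s * p) r) * S := by
  have hm (R : ℝ) : Measurable fun x =>
      ‖radialRestriction u r x - radialRestriction u R x‖ₑ ^ p :=
    (((measurable_radialRestriction hum r).sub
      (measurable_radialRestriction hum R)).enorm).pow_const p
  calc _ = ∫⁻ x, liminf (fun R => ‖radialRestriction u r x - radialRestriction u R x‖ₑ ^ p)
          (𝓝[<] 1) ∂arcLength := by
        refine lintegral_congr_ae ?_
        filter_upwards [hv] with x hx
        exact (((tendsto_const_nhds.sub hx).enorm.ennrpow_const p).liminf_eq).symm
    _ ≤ liminf (fun R => ∫⁻ x, ‖radialRestriction u r x - radialRestriction u R x‖ₑ ^ p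
          ∂arcLength) (𝓝[<] 1) := lintegral_liminf_le hm
    _ ≤ _ := by
        refine liminf_le_of_frequently_le' (Eventually.frequently ?_)
        filter_upwards [Ioo_mem_nhdsLT_one hr.2] with R hR
        have hR0 : 0 < R := hr.1.trans hR.1
        have hmR := measurable_radialRestriction hum R
        refine (lintegral_mono fun x => enorm_radialRestriction_sub_rpow_le hs hp hu hr.1.le
          hR.1 hR.2 x).trans ?_
        rw [lintegral_const_mul _ (measurable_gagliardoDensity hmR),
          lintegral_gagliardoDensity hmR]
        gcongr
        exact hE R ⟨hR0, hR.2⟩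

lemma tendsto_gagliardoQuotient (hp : 0 < p) {ι : Type*} {l : Filter ι} {g : ι → Circle → ℂ}
    {v : Circle → ℂ} {x y : Circle} (hx : Tendsto (fun i => g i x) l (𝓝 (v x)))
    (hy : Tendsto (fun i => g i y) l (𝓝 (v y))) :
    Tendsto (fun i => gagliardoQuotient s p (g i) x y) l (𝓝 (gagliardoQuotient s p v x y)) := by
  rcases eq_or_ne x y with rfl | hxy
  · simpa [gagliardoQuotient, hp] using tendsto_const_nhds
  refine ENNReal.Tendsto.div_const ((hx.sub hy).enorm.ennrpow_const p) (Or.inr ?_)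
  have : (x : ℂ) - y ≠ 0 := sub_ne_zero.2 fun h => hxy (Circle.ext h)
  simp [ENNReal.rpow_eq_zero_iff, this]

/-- Lower semicontinuity of the energy under almost everywhere convergence. -/
lemma gagliardoEnergy_le_liminf (hp : 0 < p) {ι : Type*} {l : Filter ι} [l.NeBot]
    [l.IsCountablyGenerated] {g : ι → Circle → ℂ} (hg : ∀ i, Measurable (g i)) {v : Circle → ℂ}
    (hv : ∀ᵐ x ∂arcLength, Tendsto (fun i => g i x) l (𝓝 (v x))) :
    gagliardoEnergy s p v ≤ liminf (fun i => gagliardoEnergy s p (g i)) l := by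
  refine le_trans (le_of_eq ?_)
    (lintegral_liminf_le fun i => measurable_gagliardoQuotient (s := s) (p := p) (hg i))
  refine lintegral_congr_ae ?_
  filter_upwards [Measure.quasiMeasurePreserving_fst.ae hv,
    Measure.quasiMeasurePreserving_snd.ae hv] with z h1 h2
  exact (tendsto_gagliardoQuotient hp h1 h2).liminf_eq.symm

lemma gagliardoQuotient_sub_le (hp : 1 ≤ p) (g h : Circle → ℂ) (x y : Circle) :
    gagliardoQuotient s p (g - h) x y ≤
      2 ^ (p - 1) * (gagliardoQuotient s p g x y + gagliardoQuotient s p h x y) := by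
  have h1 : ‖(g - h) x - (g - h) y‖ₑ ≤ ‖g x - g y‖ₑ + ‖h x - h y‖ₑ := by
    have : (g - h) x - (g - h) y = (g x - g y) - (h x - h y) := by
      simp only [Pi.sub_apply]; ring
    rw [this]
    exact enorm_sub_le
  simp only [gagliardoQuotient]
  rw [← ENNReal.add_div, ← mul_div_assoc]
  gcongr
  exact (ENNReal.rpow_le_rpow h1 (by linarith)).trans
    (ENNReal.rpow_add_le_mul_rpow_add_rpow _ _ hp)

/-- The Poisson measure has bounded density, so it is dominated by arc length. -/
lemma lintegral_poissonMeasure_le {r : ℝ} (h0 : 0 ≤ r) (h1 : r < 1) (x : Circle)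
    (h : Circle → ℝ≥0∞) :
    ∫⁻ t, h (x * t) ∂poissonMeasure r ≤
      ENNReal.ofReal ((1 - r) ^ 2)⁻¹ * ∫⁻ t, h t ∂arcLength := by
  rw [poissonMeasure]
  refine (lintegral_withDensity_le_lintegral_mul _ (measurable_poissonDensity r) _).trans ?_
  rw [← lintegral_mul_left_eq_self (μ := arcLength) h x,
    ← lintegral_const_mul' _ _ ENNReal.ofReal_ne_top]
  refine lintegral_mono fun t => ?_
  simp only [Pi.mul_apply]
  gcongr
  have hm : 1 - r ≤ ‖(t : ℂ) - r‖ := by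
    have := norm_sub_norm_le (t : ℂ) (r : ℂ)
    rwa [Circle.norm_coe, Complex.norm_real, Real.norm_of_nonneg h0] at this
  have ha : 0 < 1 - r := by linarith
  have hk0 := poissonKernel_circle_nonneg h0 h1 t
  refine (mul_le_of_le_one_left hk0 (inv_le_one_of_one_le₀ ?_)).trans ?_
  · linarith [Real.pi_gt_three]
  · rw [poissonKernel_circle, ← one_div]
    gcongr
    nlinarith

/-- `u_r` is the Poisson average of the boundary function. -/
lemma integral_poissonMeasure_boundary (hs : 0 < s) (hp : 1 < p)
    (hu : AnalyticOnNhd ℂ u (Metric.ball 0 1)) (hum : Measurable u) {S : ℝ≥0∞} (hS : S ≠ ⊤)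
    (hE : ∀ r ∈ Ioo (0 : ℝ) 1, gagliardoEnergy s p (radialRestriction u r) ≤ S)
    {v : Circle → ℂ} (hvm : Measurable v)
    (hv : ∀ᵐ x ∂arcLength, Tendsto (fun r => radialRestriction u r x) (𝓝[<] 1) (𝓝 (v x)))
    (hvp : MemLpCircle p v) {r : ℝ} (hr : r ∈ Ioo (0 : ℝ) 1) (x : Circle) :
    Integrable (fun t => v (x * t)) (poissonMeasure r) ∧
      ∫ t, v (x * t) ∂poissonMeasure r = radialRestriction u r x := by
  have hp0 : 0 < p := by linarith
  have := isProbabilityMeasure_poissonMeasure hr.1.le hr.2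
  have hvxm : Measurable fun t => v (x * t) := hvm.comp (measurable_const_mul x)
  have hvint : Integrable v arcLength :=
    (hvp.mono_exponent (by simpa using hp.le)).integrable le_rfl
  refine ⟨⟨hvxm.aestronglyMeasurable, ?_⟩, ?_⟩
  · refine (lintegral_poissonMeasure_le hr.1.le hr.2 x fun t => ‖v t‖ₑ).trans_lt ?_
    exact ENNReal.mul_lt_top ENNReal.ofReal_lt_top hvint.2
  have hL1 : Tendsto (fun R => ∫⁻ t, ‖radialRestriction u R (x * t) - v (x * t)‖ₑ
      ∂poissonMeasure r) (𝓝[<] 1) (𝓝 0) := by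
    have hup : Tendsto (fun R => (ENNReal.ofReal ((1 - r) ^ 2)⁻¹ *
        (ENNReal.ofReal (poissonRate (s * p) R) * S)) ^ (1 / p)) (𝓝[<] 1) (𝓝 0) := by
      have h1 := (ENNReal.Tendsto.const_mul (a := ENNReal.ofReal ((1 - r) ^ 2)⁻¹)
        (ENNReal.Tendsto.mul_const (b := S) (tendsto_poissonRate (mul_pos hs hp0))
          (Or.inr hS)) (Or.inr ENNReal.ofReal_ne_top)).ennrpow_const (1 / p)
      rwa [zero_mul, mul_zero, ENNReal.zero_rpow_of_pos (by positivity)] at h1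
    refine tendsto_of_tendsto_of_tendsto_of_le_of_le' tendsto_const_nhds hup
      (Eventually.of_forall fun _ => zero_le) ?_
    filter_upwards [Ioo_mem_nhdsLT_one one_pos] with R hR
    have hm : Measurable fun t => radialRestriction u R (x * t) - v (x * t) :=
      ((measurable_radialRestriction hum R).comp (measurable_const_mul x)).sub hvxm
    have h2 := eLpNorm_le_eLpNorm_of_exponent_le (μ := poissonMeasure r)
      (p := 1) (q := ENNReal.ofReal p) (by simpa using hp.le) hm.aestronglyMeasurable
    rw [eLpNorm_one_eq_lintegral_enorm, eLpNorm_eq_lintegral_rpow_enorm_toReal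
      (by simpa using hp0) ENNReal.ofReal_ne_top, ENNReal.toReal_ofReal hp0.le] at h2
    refine h2.trans ?_
    gcongr
    refine (lintegral_poissonMeasure_le hr.1.le hr.2 x
      fun t => ‖radialRestriction u R t - v t‖ₑ ^ p).trans ?_
    gcongr
    exact lintegral_radialRestriction_sub_le hs hp hu hum hE hv hR
  have hlim := tendsto_integral_of_L1 (fun t => v (x * t)) hvxm.aestronglyMeasurable
    (F := fun R t => radialRestriction u R (x * t)) (l := 𝓝[<] 1) (by
      filter_upwards [Ioo_mem_nhdsLT_one one_pos] with R hR
      exact ((continuous_radialRestriction hu hR.1.le hR.2).comp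
        (continuous_const_mul x)).integrable_of_hasCompactSupport
          (HasCompactSupport.of_compactSpace _)) hL1
  -- the averages of `u_R` are the values `u (r R x)`, which converge by continuity of `u`
  have hlim' : Tendsto (fun R : ℝ => ∫ t, radialRestriction u R (x * t) ∂poissonMeasure r)
      (𝓝[<] 1) (𝓝 (radialRestriction u r x)) := by
    have h1 : Tendsto (fun R : ℝ => u ((R : ℂ) * ((r : ℂ) * x))) (𝓝 1)
        (𝓝 (u (((1 : ℝ) : ℂ) * ((r : ℂ) * x)))) := by
      have h2 : ContinuousAt u (((1 : ℝ) : ℂ) * ((r : ℂ) * x)) := by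
        rw [Complex.ofReal_one, one_mul]
        exact (hu _ (mul_circle_mem_ball hr.1.le hr.2 x)).continuousAt
      exact h2.tendsto.comp
        ((Complex.continuous_ofReal.mul continuous_const).tendsto (1 : ℝ))
    rw [Complex.ofReal_one, one_mul] at h1
    refine (h1.mono_left nhdsWithin_le_nhds).congr' ?_
    filter_upwards [Ioo_mem_nhdsLT_one one_pos] with R hR
    exact (integral_poissonMeasure (diffContOnCl_dilation hu hR.1.le hR.2) hr.1.le hr.2 x).symm
  exact tendsto_nhds_unique hlim hlim'

end Radial

/-! ### Convergence in the Hardy and fractional Sobolev spaces -/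

lemma lintegral_Ioo_circleExp {f : Circle → ℝ≥0∞} (hf : Measurable f) :
    ∫⁻ θ in Ioo 0 (2 * Real.pi), f (Circle.exp θ) = ∫⁻ x, f x ∂arcLength := by
  rw [lintegral_arcLength hf 0, zero_add, restrict_Ioo_eq_restrict_Ioc]

lemma gagliardoEnergy_le_of_supGagliardo {s p : ℝ} (hp : 0 < p) {u : ℂ → ℂ}
    (hu : AnalyticOnNhd ℂ u (Metric.ball 0 1)) {r : ℝ} (hr : r ∈ Ioo (0 : ℝ) 1) :
    gagliardoEnergy s p (radialRestriction u r) ≤ supGagliardo s p u ^ p := by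
  have h1 : gagliardoSeminorm s p (radialRestriction u r) ≤ supGagliardo s p u :=
    le_iSup₂ (f := fun r (_ : r ∈ Ioo (0 : ℝ) 1) =>
      gagliardoSeminorm s p (radialRestriction u r)) r hr
  rw [gagliardoSeminorm_eq (continuous_radialRestriction hu hr.1.le hr.2).measurable, one_div,
    ENNReal.rpow_inv_le_iff hp] at h1
  exact h1

lemma memHardy_of_supGagliardo_lt_top {s p : ℝ} (hs : 0 < s) (hp : 1 < p) {u : ℂ → ℂ}
    (hu : AnalyticOnNhd ℂ u (Metric.ball 0 1)) (hsup : supGagliardo s p u < ⊤) :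
    MemHardy p u := by
  have hp0 : 0 < p := by linarith
  obtain ⟨B, hB, hle⟩ := exists_lintegral_radialRestriction_le hs hp hu
    (ENNReal.rpow_ne_top_of_nonneg hp0.le hsup.ne)
    fun r hr => gagliardoEnergy_le_of_supGagliardo hp0 hu hr
  refine ⟨hu, lt_of_le_of_lt (iSup₂_le fun r hr => ?_)
    (ENNReal.rpow_lt_top_of_nonneg (one_div_pos.2 hp0).le
      (ENNReal.mul_ne_top (ENNReal.ofReal_ne_top (r := 1 / (2 * Real.pi))) hB))⟩
  gcongr
  refine le_trans (le_of_eq ?_) (hle r hr)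
  exact lintegral_Ioo_circleExp (f := fun x => ‖radialRestriction u r x‖ₑ ^ p)
    ((continuous_radialRestriction hu hr.1 hr.2).measurable.enorm.pow_const p)

lemma eLpNorm_arcLength_eq {p : ℝ} (hp : 0 < p) (g : Circle → ℂ) :
    eLpNorm g (ENNReal.ofReal p) arcLength = (∫⁻ x, ‖g x‖ₑ ^ p ∂arcLength) ^ (1 / p) := by
  rw [eLpNorm_eq_lintegral_rpow_enorm_toReal (by simpa using hp) ENNReal.ofReal_ne_top,
    ENNReal.toReal_ofReal hp.le]

/-- The boundary function and the convergence to it, for `u` measurable on the whole plane. -/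
lemma exists_boundary_trace {s p : ℝ} (hs : 0 < s) (hs1 : s < 1) (hp : 1 < p) {u : ℂ → ℂ}
    (hu : AnalyticOnNhd ℂ u (Metric.ball 0 1)) (hum : Measurable u) {S : ℝ≥0∞} (hS : S ≠ ⊤)
    (hE : ∀ r ∈ Ioo (0 : ℝ) 1, gagliardoEnergy s p (radialRestriction u r) ≤ S) :
    ∃ v : Circle → ℂ,
      MemFracSobolev s p v ∧
      (∀ᵐ x ∂arcLength, Tendsto (fun r => radialRestriction u r x) (𝓝[<] 1) (𝓝 (v x))) ∧
      Tendsto (fun r => eLpNorm (radialRestriction u r - v) (ENNReal.ofReal p) arcLength)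
        (𝓝[<] 1) (𝓝 0) ∧
      Tendsto (fun r => gagliardoSeminorm s p (radialRestriction u r - v)) (𝓝[<] 1) (𝓝 0) ∧
      Tendsto (fun r => gagliardoSeminorm s p (radialRestriction u r)) (𝓝[<] 1)
        (𝓝 (gagliardoSeminorm s p v)) := by
  have hp0 : 0 < p := by linarith
  have hrm := measurable_radialRestriction hum
  obtain ⟨v, hvm, hv⟩ := measurable_limit_of_tendsto_metrizable_ae
    (fun r => (hrm r).aemeasurable) (ae_exists_radial_limit hs hp hu hum hS hE)
  have hLp {r : ℝ} (hr : r ∈ Ioo (0 : ℝ) 1) :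
      eLpNorm (radialRestriction u r - v) (ENNReal.ofReal p) arcLength ≤
        (ENNReal.ofReal (poissonRate (s * p) r) * S) ^ (1 / p) := by
    rw [eLpNorm_arcLength_eq hp0]
    exact ENNReal.rpow_le_rpow (lintegral_radialRestriction_sub_le hs hp hu hum hE hv hr)
      (one_div_pos.2 hp0).le
  have hvp : MemLpCircle p v := by
    have hr : (1 / 2 : ℝ) ∈ Ioo (0 : ℝ) 1 := by constructor <;> norm_num
    have h1 : MemLp (radialRestriction u (1 / 2) - v) (ENNReal.ofReal p) arcLength :=
      ⟨((hrm _).sub hvm).aestronglyMeasurable, (hLp hr).trans_lt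
        (ENNReal.rpow_lt_top_of_nonneg (one_div_pos.2 hp0).le
          (ENNReal.mul_ne_top ENNReal.ofReal_ne_top hS))⟩
    have h2 := (memFracSobolev_radialRestriction hs1 hp0 hu hr.1.le hr.2).1.sub h1
    rwa [sub_sub_cancel] at h2
  have hlower : gagliardoEnergy s p v ≤
      liminf (fun r => gagliardoEnergy s p (radialRestriction u r)) (𝓝[<] 1) :=
    gagliardoEnergy_le_liminf hp0 hrm hv
  have hvE : gagliardoEnergy s p v ≤ S := by
    refine hlower.trans (liminf_le_of_frequently_le' (Eventually.frequently ?_))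
    filter_upwards [Ioo_mem_nhdsLT_one one_pos] with R hR using hE R hR
  have hvE' : gagliardoEnergy s p v ≠ ⊤ := ne_top_of_le_ne_top hS hvE
  -- `u_r` averages the rotations of `v`
  have hupper : ∀ᶠ r in 𝓝[<] (1 : ℝ),
      gagliardoEnergy s p (radialRestriction u r) ≤ gagliardoEnergy s p v := by
    filter_upwards [Ioo_mem_nhdsLT_one one_pos] with r hr
    have := isProbabilityMeasure_poissonMeasure hr.1.le hr.2
    have hrep := integral_poissonMeasure_boundary hs hp hu hum hS hE hvm hv hvp hr
    exact gagliardoEnergy_average_le hp.le hvm (fun x => (hrep x).1) fun x => (hrep x).2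
  have hconv : Tendsto (fun r => gagliardoEnergy s p (radialRestriction u r)) (𝓝[<] 1)
      (𝓝 (gagliardoEnergy s p v)) :=
    tendsto_of_le_liminf_of_limsup_le hlower (limsup_le_of_le (by isBoundedDefault) hupper)
  have hdiff : Tendsto (fun r => gagliardoEnergy s p (radialRestriction u r - v)) (𝓝[<] 1)
      (𝓝 0) := by
    refine tendsto_lintegral_zero_of_le_add (K := 2 ^ (p - 1))
      (ENNReal.rpow_ne_top_of_nonneg (by linarith) ENNReal.ofNat_ne_top)
      (fun r => measurable_gagliardoQuotient ((hrm r).sub hvm))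
      (fun r => measurable_gagliardoQuotient (hrm r)) (measurable_gagliardoQuotient hvm)
      (fun r z => gagliardoQuotient_sub_le hp.le _ _ _ _) ?_ ?_ hupper hvE'
    · filter_upwards [Measure.quasiMeasurePreserving_fst.ae hv,
        Measure.quasiMeasurePreserving_snd.ae hv] with z h1 h2
      have h3 := tendsto_gagliardoQuotient (s := s) (v := 0) (x := z.1) (y := z.2)
        (g := fun r => radialRestriction u r - v) hp0
        (by simpa using h1.sub (tendsto_const_nhds (x := v z.1)))
        (by simpa using h2.sub (tendsto_const_nhds (x := v z.2)))
      simpa [gagliardoQuotient, hp0] using h3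
    · filter_upwards [Measure.quasiMeasurePreserving_fst.ae hv,
        Measure.quasiMeasurePreserving_snd.ae hv] with z h1 h2
      exact tendsto_gagliardoQuotient hp0 h1 h2
  refine ⟨v, ⟨hvp, ?_⟩, hv, ?_, ?_, ?_⟩
  · rw [gagliardoSeminorm_eq hvm]
    exact ENNReal.rpow_lt_top_of_nonneg (one_div_pos.2 hp0).le hvE'
  · have h1 := (ENNReal.Tendsto.mul_const (b := S) (tendsto_poissonRate (mul_pos hs hp0))
      (Or.inr hS)).ennrpow_const (1 / p)
    rw [zero_mul, ENNReal.zero_rpow_of_pos (by positivity)] at h1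
    refine tendsto_of_tendsto_of_tendsto_of_le_of_le' tendsto_const_nhds h1
      (Eventually.of_forall fun _ => zero_le) ?_
    filter_upwards [Ioo_mem_nhdsLT_one one_pos] with r hr using hLp hr
  · have h1 := hdiff.ennrpow_const (1 / p)
    rw [ENNReal.zero_rpow_of_pos (by positivity)] at h1
    exact h1.congr fun r => (gagliardoSeminorm_eq ((hrm r).sub hvm)).symm
  · rw [gagliardoSeminorm_eq hvm]
    exact (hconv.ennrpow_const (1 / p)).congr fun r => (gagliardoSeminorm_eq (hrm r)).symm

theorem mainTheorem1 (s p : ℝ) (hs0 : 0 < s) (hs1 : s < 1) (hp : 1 < p)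
    (u : ℂ → ℂ) (hu : AnalyticOnNhd ℂ u (Metric.ball 0 1)) :
    (∀ r ∈ Ioo (0 : ℝ) 1,
      ContMDiff (𝓡 1) 𝓘(ℝ, ℂ) ∞ (radialRestriction u r) ∧
      MemFracSobolev s p (radialRestriction u r)) ∧
    (supGagliardo s p u < ⊤ →
      MemHardy p u ∧
      ∃ uStar : Circle → ℂ,
        MemLpCircle p uStar ∧
        (∀ᵐ θ ∂(volume.restrict (Ioo (-Real.pi) Real.pi)),
          Tendsto (fun r : ℝ => u ((r : ℂ) * (Circle.exp θ : ℂ))) (𝓝[<] 1)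
            (𝓝 (uStar (Circle.exp θ)))) ∧
        Tendsto (fun r : ℝ =>
            eLpNorm (radialRestriction u r - uStar) (ENNReal.ofReal p) arcLength)
          (𝓝[<] 1) (𝓝 0) ∧
        MemFracSobolev s p uStar ∧
        Tendsto (fun r : ℝ => gagliardoSeminorm s p (radialRestriction u r - uStar))
          (𝓝[<] 1) (𝓝 0) ∧
        Tendsto (fun r : ℝ => gagliardoSeminorm s p (radialRestriction u r))
          (𝓝[<] 1) (𝓝 (gagliardoSeminorm s p uStar))) := by
  have hp0 : 0 < p := by linarith
  refine ⟨fun r hr => ⟨contMDiff_radialRestriction hu hr.1.le hr.2,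
    memFracSobolev_radialRestriction hs1 hp0 hu hr.1.le hr.2⟩, fun hsup =>
    ⟨memHardy_of_supGagliardo_lt_top hs0 hp hu hsup, ?_⟩⟩
  -- `u` is arbitrary off the disc; cutting it off there makes it measurable
  set w : ℂ → ℂ := (Metric.ball (0 : ℂ) 1).indicator u
  have hwu : EqOn u w (Metric.ball 0 1) := fun z hz => (indicator_of_mem hz u).symm
  have hw : AnalyticOnNhd ℂ w (Metric.ball 0 1) := hu.congr Metric.isOpen_ball hwu
  have hwm : Measurable w := by
    classical
    rw [show w = (Metric.ball (0 : ℂ) 1).piecewise u 0 from (piecewise_eq_indicator).symm]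
    exact hu.continuousOn.measurable_piecewise continuousOn_const measurableSet_ball
  have hres {r : ℝ} (hr : r ∈ Ioo (0 : ℝ) 1) : radialRestriction w r = radialRestriction u r :=
    funext fun x => (hwu (mul_circle_mem_ball hr.1.le hr.2 x)).symm
  have hev : ∀ᶠ r in 𝓝[<] (1 : ℝ), radialRestriction w r = radialRestriction u r := by
    filter_upwards [Ioo_mem_nhdsLT_one one_pos] with r hr using hres hr
  obtain ⟨v, hvW, hv, hvp, hvs, hvn⟩ := exists_boundary_trace hs0 hs1 hp hw hwm
    (ENNReal.rpow_ne_top_of_nonneg hp0.le hsup.ne) fun r hr => by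
      rw [hres hr]; exact gagliardoEnergy_le_of_supGagliardo hp0 hu hr
  refine ⟨v, hvW.1, ?_, hvp.congr' (hev.mono fun r hr => by rw [hr]), hvW,
    hvs.congr' (hev.mono fun r hr => by rw [hr]), hvn.congr' (hev.mono fun r hr => by rw [hr])⟩
  filter_upwards [ae_of_ae_map measurable_circleExp.aemeasurable hv] with θ hθ
  exact hθ.congr' (hev.mono fun r hr => congrFun hr (Circle.exp θ))
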